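/- \textbf{Setting.} A convex function $f:\mathbb{R}^d\to\mathbb{R}$ is called $1$-smooth if it is differentiable and $\nabla f$ is $1$-Lipschitz. For $n\ge 0$ and a stepsize schedule $h=(h_0,\dots,h_{n-1})\in\mathbb{R}^n$ with all $h_i>0$, gradient descent with schedule $h$ on $f$ from $x_0$ produces $x_{i+1}=x_i-h_i\nabla f(x_i)$ for $0\le i<n$. The schedule $h$ is called \emph{s-composable with rate $\eta$} if, for every dimension $d$, every $1$-smooth convex $f:\mathbb{R}^d\to\mathbb{R}$, every minimizer $x_\star$ of $f$ and every $x_0\in\mathbb{R}^d$, $$\tfrac{1-\eta}{2}\|\nabla f(x_n)\|^2+\tfrac{\eta^2}{2}\|x_n-x_\star\|^2+(\eta-\eta^2)\big(f(x_n)-f(x_\star)\big)\le \tfrac{\eta^2}{2}\|x_0-x_\star\|^2,$$ and moreover $\eta=\frac{1}{1+\sum_{i=0}^{n-1}h_i}=\prod_{i=0}^{n-1}(h_i-1)$. (Empty sums are $0$ and empty products are $1$.) Let $q(x)=\frac12x^2$ on $\mathbb{R}$ and, for $\delta>0$, let $H_\delta(x)=\frac12x^2$ if $|x|\le\delta$ and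 $H_\delta(x)=\delta|x|-\frac{\delta^2}{2}$ otherwise. These functions are convex and $1$-smooth, with minimizer $0$. \textbf{Proposition.} Let $h$ be s-composable with rate $\eta$. Then for every $d$, every $1$-smooth convex $f:\mathbb{R}^d\to\mathbb{R}$, every minimizer $x_\star$ of $f$ and every $x_0\in\mathbb{R}^d$, gradient descent with schedule $h$ satisfies both $$f(x_n)-f(x_\star)\le\frac{1}{1+2\sum_{i=0}^{n-1}h_i}\Big(\tfrac12\|x_0-x_\star\|^2-\tfrac12\big\|x_n-x_\star-\tfrac{1}{\eta}\nabla f(x_n)\big\|^2\Big)$$ and $$\tfrac12\|\nabla f(x_n)\|^2\le\frac{1}{1+2\sum_{i=0}^{n-1}h_i}\Big(f(x_0)-f(x_\star)-\tfrac12\big\|\nabla f(x_0)-\eta\sum_{i=0}^{n-1}h_i\nabla f(x_i)-\eta\nabla f(x_n)\big\|^2\Big).$$ Both bounds are tight. In dimension one with $x_0=1$ and $x_\star=0$: the first holds with equality when $f=q$ and when $f=H_{\eta/(2-\eta)}$, and in the latter case the bracketed term equals $\frac12\|x_0-x_\star\|^2$; the second holds with equality when $f=q$ and when $f=H_\eta$,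 and in the latter case the bracketed term equals $f(x_0)-f(x_\star)$. -/

import Mathlib

noncomputable section

/-- `f` is convex and `1`-smooth: differentiable everywhere with `1`-Lipschitz gradient. -/
structure IsOneSmoothConvex {E : Type*} [NormedAddCommGroup E] [InnerProductSpace ℝ E]
    [CompleteSpace E] (f : E → ℝ) : Prop where
  convex : ConvexOn ℝ Set.univ f
  differentiable : Differentiable ℝ f
  lipschitz_gradient : LipschitzWith 1 (gradient f)

/-- `xs` is a (global) minimizer of `f`. -/
def IsGlobalMinimizer {E : Type*} (f : E → ℝ) (xs : E) : Prop :=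
  ∀ y, f xs ≤ f y

/-- The iterates `x_0, …, x_n` of gradient descent on `f` started at `x₀`, with stepsizes
`h_0, …, h_{n-1}`: `x_{i+1} = x_i - h_i ∇f(x_i)`. -/
def gdIterates {E : Type*} [NormedAddCommGroup E] [InnerProductSpace ℝ E] [CompleteSpace E]
    (f : E → ℝ) {n : ℕ} (h : Fin n → ℝ) (x₀ : E) : Fin (n + 1) → E :=
  Fin.induction x₀ (fun i xi => xi - h i • gradient f xi)

theorem gdIterates_zero {E : Type*} [NormedAddCommGroup E] [InnerProductSpace ℝ E]
    [CompleteSpace E] (f : E → ℝ) {n : ℕ} (h : Fin n → ℝ) (x₀ : E) :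
    gdIterates f h x₀ 0 = x₀ := rfl

theorem gdIterates_succ {E : Type*} [NormedAddCommGroup E] [InnerProductSpace ℝ E]
    [CompleteSpace E] (f : E → ℝ) {n : ℕ} (h : Fin n → ℝ) (x₀ : E) (i : Fin n) :
    gdIterates f h x₀ i.succ =
      gdIterates f h x₀ i.castSucc - h i • gradient f (gdIterates f h x₀ i.castSucc) := rfl

/-- The last iterate `x_n`. -/
def gdLast {E : Type*} [NormedAddCommGroup E] [InnerProductSpace ℝ E] [CompleteSpace E]
    (f : E → ℝ) {n : ℕ} (h : Fin n → ℝ) (x₀ : E) : E :=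
  gdIterates f h x₀ (Fin.last n)

/-- The positive stepsize schedule `h` is s-composable with rate `η`. The inequality is required
in every ambient dimension `d`, for every minimizer `xs` and every starting point `x₀`. -/
structure IsSComposable {n : ℕ} (h : Fin n → ℝ) (η : ℝ) : Prop where
  pos : ∀ i, 0 < h i
  bound : ∀ (d : ℕ) (f : EuclideanSpace ℝ (Fin d) → ℝ), IsOneSmoothConvex f →
    ∀ xs, IsGlobalMinimizer f xs → ∀ x₀,
      (1 - η) / 2 * ‖gradient f (gdLast f h x₀)‖ ^ 2
        + η ^ 2 / 2 * ‖gdLast f h x₀ - xs‖ ^ 2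
        + (η - η ^ 2) * (f (gdLast f h x₀) - f xs)
      ≤ η ^ 2 / 2 * ‖x₀ - xs‖ ^ 2
  rate_sum : η = 1 / (1 + ∑ i, h i)
  rate_prod : η = ∏ i, (h i - 1)

/-- `½‖x_0 - x⋆‖² - ½‖x_n - x⋆ - ∇f(x_n)/η‖²` -/
def objBracket {E : Type*} [NormedAddCommGroup E] [InnerProductSpace ℝ E] [CompleteSpace E]
    (f : E → ℝ) {n : ℕ} (h : Fin n → ℝ) (η : ℝ) (x₀ xs : E) : ℝ :=
  1 / 2 * ‖x₀ - xs‖ ^ 2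
    - 1 / 2 * ‖gdLast f h x₀ - xs - (1 / η) • gradient f (gdLast f h x₀)‖ ^ 2

/-- `f(x_0) - f(x⋆) - ½‖∇f(x_0) - η ∑_{i<n} h_i ∇f(x_i) - η ∇f(x_n)‖²` -/
def gradBracket {E : Type*} [NormedAddCommGroup E] [InnerProductSpace ℝ E] [CompleteSpace E]
    (f : E → ℝ) {n : ℕ} (h : Fin n → ℝ) (η : ℝ) (x₀ xs : E) : ℝ :=
  f x₀ - f xs
    - 1 / 2 * ‖gradient f x₀
        - η • ∑ i : Fin n, h i • gradient f (gdIterates f h x₀ i.castSucc)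
        - η • gradient f (gdLast f h x₀)‖ ^ 2

/-- The one-dimensional quadratic `q(x) = x²/2`. -/
def quadFun (x : ℝ) : ℝ := 1 / 2 * x ^ 2

/-- The one-dimensional Huber function `H_δ`. -/
def huberFun (δ x : ℝ) : ℝ := if |x| ≤ δ then 1 / 2 * x ^ 2 else δ * |x| - δ ^ 2 / 2

end

/-! Write S for the sum of the stepsizes, so that η(1+S) = 1, and f_i, g_i for the values and
gradients along the iterates. The objective bound is the s-composable inequality plus η times
cocoercivity between x_n and x⋆.

The gradient bound needs an inequality that does not mention a minimizer, namely
`IsSComposable.sExcess_nonneg`. Smooth convex interpolation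
(`exists_isOneSmoothConvex_interpolating`) turns the hypothesis into a statement about finite data,
in which the minimizer may be chosen adversarially. If the gradients are linearly independent, x⋆
can be placed so that every interpolation inequality from x⋆ to an iterate is an equality. The
distances to x⋆ then telescope, and x⋆ and f(x⋆) cancel from the s-composable inequality. General
data are reached as a limit: take the orthogonal product with ε times the data of a quadratic whose
gradients are independent, and let ε tend to 0.

Adding the inequalities between a fixed x_k and all earlier steps, weighted by h_i, removes the
intermediate iterates (`IsSComposable.comparison`). The cases k = 0 and k = n, with the inequality
between x_0 and x_n, give the bound up to f_0 - f_n, and f_n - f(x⋆) ≥ ½‖g_n‖² completes it.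

Tightness is direct computation: on q the last iterate is ±η, and on the Huber functions the
iterates never leave the linear piece. -/

/-- The slack of the smooth convex interpolation inequality between the points `i` and `j`. -/
noncomputable def interpGap {ι E : Type*} [NormedAddCommGroup E] [InnerProductSpace ℝ E]
    (x g : ι → E) (f : ι → ℝ) (i j : ι) : ℝ :=
  f i - f j - inner ℝ (g j) (x i - x j) - 1 / 2 * ‖g i - g j‖ ^ 2

/-! ### Cocoercivity and smooth convex interpolation -/

section Smooth

variable {E : Type*} [NormedAddCommGroup E] [InnerProductSpace ℝ E] [CompleteSpace E]

/-- The inequalities in both directions trap the first-order remainder between 0 and ⟪G y - G x, y -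
x⟫ - ½‖G y - G x‖², which is at most ½‖y - x‖². -/
theorem hasGradientAt_of_cocoercive {f : E → ℝ} {G : E → E}
    (h : ∀ x y, 0 ≤ interpGap id G f y x) (x : E) : HasGradientAt f (G x) x := by
  rw [hasGradientAt_iff_isLittleO]
  refine Asymptotics.IsBigO.trans_isLittleO (g := fun y => ‖y - x‖ ^ 2) ?_ ?_
  · refine Asymptotics.IsBigO.of_bound 1 (Filter.Eventually.of_forall fun y => ?_)
    have h1 := h x y
    have h2 := h y x
    simp only [interpGap, id] at h1 h2
    have h3 : inner ℝ (G y) (x - y) = -inner ℝ (G y) (y - x) := by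
      rw [← inner_neg_right, neg_sub]
    have h4 : ‖(G y - G x) - (y - x)‖ ^ 2
        = ‖G y - G x‖ ^ 2 - 2 * (inner ℝ (G y) (y - x) - inner ℝ (G x) (y - x)) + ‖y - x‖ ^ 2 := by
      rw [norm_sub_sq_real, inner_sub_left]
    have h5 := norm_sub_rev (G x) (G y)
    rw [h5] at h2
    have h6 := sq_nonneg ‖(G y - G x) - (y - x)‖
    have h7 := sq_nonneg ‖G y - G x‖
    rw [Real.norm_eq_abs, abs_of_nonneg (by linarith), norm_pow, norm_norm]
    nlinarith
  · have : (fun y => ‖y - x‖ ^ 2) = fun y => (fun z : E => ‖z‖ ^ 2) (y - x) := rfl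
    refine Asymptotics.isLittleO_norm_right.1 ?_
    have h0 : Filter.Tendsto (fun y => y - x) (nhds x) (nhds 0) := by
      have : Continuous fun y => y - x := by fun_prop
      simpa using this.tendsto x
    have := (Asymptotics.isLittleO_norm_pow_id (E' := E) (n := 2) (by norm_num)).comp_tendsto h0
    exact Asymptotics.isLittleO_norm_right.2 this

/-- Lets the interpolant, q and the Huber functions be treated by checking one inequality, with no
separate computation of derivatives. -/
theorem isOneSmoothConvex_of_cocoercive {f : E → ℝ} {G : E → E}
    (h : ∀ x y, 0 ≤ interpGap id G f y x) : IsOneSmoothConvex f ∧ gradient f = G := by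
  have hG : gradient f = G := gradient_eq (hasGradientAt_of_cocoercive h)
  refine ⟨⟨⟨convex_univ, ?_⟩, fun x => (hasGradientAt_of_cocoercive h x).differentiableAt, ?_⟩, hG⟩
  · intro x _ y _ a b ha hb hab
    set z := a • x + b • y
    have h1 := h z x
    have h2 := h z y
    simp only [interpGap, id] at h1 h2
    have h3 : a * inner ℝ (G z) (x - z) + b * inner ℝ (G z) (y - z) = 0 := by
      rw [← real_inner_smul_right, ← real_inner_smul_right, ← inner_add_right]
      have : a • (x - z) + b • (y - z) = (1 - (a + b)) • z := by
        simp only [z]; module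
      simp [this, hab]
    simp only [smul_eq_mul]
    have h4 := mul_nonneg ha (add_nonneg h1 (by positivity : 0 ≤ 1 / 2 * ‖G x - G z‖ ^ 2))
    have h5 := mul_nonneg hb (add_nonneg h2 (by positivity : 0 ≤ 1 / 2 * ‖G y - G z‖ ^ 2))
    have h6 : a * f z + b * f z = f z := by rw [← add_mul, hab, one_mul]
    linarith
  · rw [hG]
    refine LipschitzWith.of_dist_le_mul fun x y => ?_
    rw [dist_eq_norm, dist_eq_norm, NNReal.coe_one, one_mul]
    have h1 := h x y
    have h2 := h y x
    simp only [interpGap, id] at h1 h2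
    have h3 : inner ℝ (G x) (y - x) = -inner ℝ (G x) (x - y) := by
      rw [← inner_neg_right, neg_sub]
    have h4 : inner ℝ (G x - G y) (x - y) ≤ ‖G x - G y‖ * ‖x - y‖ := real_inner_le_norm _ _
    rw [inner_sub_left] at h4
    rw [norm_sub_rev (G y)] at h1
    by_contra! hc
    nlinarith [norm_nonneg (x - y)]

theorem IsOneSmoothConvex.subgradient {f : E → ℝ} (hf : IsOneSmoothConvex f) (x y : E) :
    f x + inner ℝ (gradient f x) (y - x) ≤ f y := by
  have hline : ∀ t : ℝ, HasDerivAt (fun t : ℝ => f (x + t • (y - x)))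
      (inner ℝ (gradient f (x + t • (y - x))) (y - x)) t := by
    intro t
    have h1 : HasDerivAt (fun t : ℝ => x + t • (y - x)) (y - x) t := by
      simpa using ((hasDerivAt_id t).smul_const (y - x)).const_add x
    have h2 := (hf.differentiable (x + t • (y - x))).hasFDerivAt.comp_hasDerivAt t h1
    rwa [← inner_gradient_left] at h2
  have hconv : ConvexOn ℝ Set.univ (fun t : ℝ => f (x + t • (y - x))) := by
    refine ⟨convex_univ, fun s _ t _ a b ha hb hab => ?_⟩
    have := hf.convex.2 (Set.mem_univ (x + s • (y - x))) (Set.mem_univ (x + t • (y - x))) ha hb hab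
    have he : x + (a • s + b • t) • (y - x)
        = a • (x + s • (y - x)) + b • (x + t • (y - x)) := by
      have : x = (a + b) • x := by rw [hab, one_smul]
      nth_rewrite 1 [this]
      simp only [smul_eq_mul]
      module
    simpa only [he] using this
  have := hconv.le_slope_of_hasDerivAt (Set.mem_univ 0) (Set.mem_univ 1) one_pos (hline 0)
  simp only [slope_def_field, zero_smul, add_zero, one_smul, add_sub_cancel, sub_zero,
    div_one] at this
  linarith

theorem IsOneSmoothConvex.descent {f : E → ℝ} (hf : IsOneSmoothConvex f) (x v : E) :
    f (x + v) ≤ f x + inner ℝ (gradient f x) v + 1 / 2 * ‖v‖ ^ 2 := by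
  have hline : ∀ t : ℝ, HasDerivAt
      (fun t : ℝ => f (x + t • v) - t * inner ℝ (gradient f x) v - t ^ 2 * (1 / 2 * ‖v‖ ^ 2))
      (inner ℝ (gradient f (x + t • v)) v - inner ℝ (gradient f x) v - t * ‖v‖ ^ 2) t := by
    intro t
    have h1 : HasDerivAt (fun t : ℝ => x + t • v) v t := by
      simpa using ((hasDerivAt_id t).smul_const v).const_add x
    have h2 := (hf.differentiable (x + t • v)).hasFDerivAt.comp_hasDerivAt t h1
    rw [← inner_gradient_left] at h2
    have h3 := (hasDerivAt_id t).mul_const (inner ℝ (gradient f x) v)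
    have h4 := (hasDerivAt_pow 2 t).mul_const (1 / 2 * ‖v‖ ^ 2)
    exact ((h2.sub h3).sub h4).congr_deriv (by push_cast; ring)
  have hanti := antitoneOn_of_deriv_nonpos (convex_Icc (0 : ℝ) 1)
    (fun t _ => (hline t).continuousAt.continuousWithinAt)
    (fun t _ => (hline t).differentiableAt.differentiableWithinAt)
    (fun t ht => by
      rw [(hline t).deriv]
      rw [interior_Icc] at ht
      have h1 := real_inner_le_norm (gradient f (x + t • v) - gradient f x) v
      have h2 := hf.lipschitz_gradient.dist_le_mul (x + t • v) x
      rw [dist_eq_norm, dist_eq_norm, add_sub_cancel_left, norm_smul, Real.norm_eq_abs,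
        abs_of_pos ht.1, NNReal.coe_one, one_mul] at h2
      rw [inner_sub_left] at h1
      nlinarith [mul_le_mul_of_nonneg_right h2 (norm_nonneg v)])
  have := hanti (Set.left_mem_Icc.2 zero_le_one) (Set.right_mem_Icc.2 zero_le_one) zero_le_one
  simp only [one_smul, zero_smul, add_zero, one_mul, zero_mul, one_pow, sub_zero, ne_eq,
    OfNat.ofNat_ne_zero, not_false_eq_true, zero_pow] at this
  linarith

/-- Compare two estimates of f(y - d), where d is the difference of the gradients: from below by the
tangent at x, from above by the descent inequality at y. -/
theorem IsOneSmoothConvex.cocoercive {f : E → ℝ} (hf : IsOneSmoothConvex f) (x y : E) :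
    0 ≤ interpGap id (gradient f) f y x := by
  simp only [interpGap, id]
  set d := gradient f y - gradient f x with hd
  have h1 := hf.subgradient x (y - d)
  have h2 := hf.descent y (-d)
  rw [← sub_eq_add_neg, norm_neg, inner_neg_right] at h2
  have h3 : y - d - x = (y - x) - d := by abel
  rw [h3, inner_sub_right] at h1
  have h4 : inner ℝ (gradient f y) d - inner ℝ (gradient f x) d = ‖d‖ ^ 2 := by
    rw [← inner_sub_left, ← hd, real_inner_self_eq_norm_sq]
  linarith

theorem IsOneSmoothConvex.gradient_eq_zero {f : E → ℝ} (hf : IsOneSmoothConvex f) {xs : E}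
    (hxs : IsGlobalMinimizer f xs) : gradient f xs = 0 := by
  have h := hf.descent xs (-gradient f xs)
  have h' := hxs (xs + -gradient f xs)
  rw [inner_neg_right, real_inner_self_eq_norm_sq, norm_neg] at h
  have : ‖gradient f xs‖ ^ 2 ≤ 0 := by linarith
  exact norm_eq_zero.1 (pow_eq_zero_iff two_ne_zero |>.1 (le_antisymm this (sq_nonneg _)))

/-- Smooth convex interpolation of finitely many data `(x i, g i, f i)`. -/
theorem exists_isOneSmoothConvex_interpolating {ι : Type*} [Finite ι] [Nonempty ι]
    {x g : ι → E} {f : ι → ℝ} (h : ∀ i j, 0 ≤ interpGap x g f i j) :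
    ∃ F : E → ℝ, IsOneSmoothConvex F ∧ ∀ i, F (x i) = f i ∧ gradient F (x i) = g i := by
  -- The second coordinate is minus (f* - ½‖·‖²) at g_i. Smoothness of f makes f* - ½‖·‖² convex, so
  -- its data are convexified by the hull `K`; conjugating back after restoring ½‖·‖² gives `F`.
  set p : ι → E × ℝ := fun i => (g i, f i - inner ℝ (g i) (x i) + 1 / 2 * ‖g i‖ ^ 2) with hp
  set K : Set (E × ℝ) := convexHull ℝ (Set.range p) with hK
  have hKc : IsCompact K := (Set.finite_range p).isCompact_convexHull ℝ
  have hKn : K.Nonempty := (Set.range_nonempty p).convexHull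
  have hKconv : Convex ℝ K := convex_convexHull ℝ _
  set A : E → E × ℝ → ℝ := fun y q => q.2 + inner ℝ q.1 y - 1 / 2 * ‖q.1‖ ^ 2 with hA
  have hmax : ∀ y, ∃ q ∈ K, IsMaxOn (A y) K q := fun y =>
    hKc.exists_isMaxOn hKn (by simp only [hA]; fun_prop)
  choose m hmK hm using hmax
  -- first-order optimality of the maximiser
  have hopt : ∀ y, ∀ w ∈ K, w.2 + inner ℝ w.1 y - inner ℝ (m y).1 w.1
      ≤ (m y).2 + inner ℝ (m y).1 y - ‖(m y).1‖ ^ 2 := by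
    intro y w hw
    set u := m y
    have key : ∀ t : ℝ, 0 < t → t ≤ 1 → (w.2 + inner ℝ w.1 y) - (u.2 + inner ℝ u.1 y)
        - inner ℝ u.1 (w.1 - u.1) ≤ t * (1 / 2 * ‖w.1 - u.1‖ ^ 2) := by
      intro t ht ht1
      have h1 := hm y (hKconv.add_smul_sub_mem (hmK y) hw ⟨ht.le, ht1⟩)
      simp only [hA, Set.mem_ofPred_eq, Prod.fst_add, Prod.snd_add, Prod.smul_fst, Prod.smul_snd,
        Prod.fst_sub, Prod.snd_sub, smul_eq_mul] at h1
      change u.2 + t * (w.2 - u.2) + inner ℝ (u.1 + t • (w.1 - u.1)) y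
        - 1 / 2 * ‖u.1 + t • (w.1 - u.1)‖ ^ 2 ≤ u.2 + inner ℝ u.1 y - 1 / 2 * ‖u.1‖ ^ 2 at h1
      rw [norm_add_sq_real, inner_add_left, real_inner_smul_left, real_inner_smul_right, norm_smul,
        Real.norm_eq_abs, mul_pow, sq_abs] at h1
      rw [inner_sub_left w.1 u.1 y] at h1
      refine le_of_mul_le_mul_left ?_ ht
      linarith
    have h0 : (w.2 + inner ℝ w.1 y) - (u.2 + inner ℝ u.1 y) - inner ℝ u.1 (w.1 - u.1) ≤ 0 := by
      by_contra! hc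
      set c := (w.2 + inner ℝ w.1 y) - (u.2 + inner ℝ u.1 y) - inner ℝ u.1 (w.1 - u.1)
      set D := 1 / 2 * ‖w.1 - u.1‖ ^ 2
      have hD : 0 ≤ D := by positivity
      -- This t satisfies tD < c, also when D = 0, contradicting `key`.
      have h2 := key (c / (c + D)) (by positivity) (by rw [div_le_one (by positivity)]; linarith)
      rw [div_mul_eq_mul_div, le_div_iff₀ (by positivity)] at h2
      nlinarith
    rw [inner_sub_right, real_inner_self_eq_norm_sq] at h0
    linarith
  set F : E → ℝ := fun y => A y (m y) with hF
  have hcoc : ∀ y z, 0 ≤ interpGap id (fun y => (m y).1) F z y := by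
    intro y z
    have h1 := hopt z (m y) (hmK y)
    simp only [interpGap, hF, hA, id]
    rw [norm_sub_sq_real, inner_sub_right]
    linarith
  obtain ⟨hF1, hF2⟩ := isOneSmoothConvex_of_cocoercive hcoc
  refine ⟨F, hF1, fun i => ?_⟩
  -- The interpolation inequalities are the optimality condition for `p i` at `x i`, tested on the
  -- generators; being affine in w, it passes to the hull.
  have hlin : ∀ w ∈ K, w.2 + inner ℝ w.1 (x i) - inner ℝ (g i) w.1
      ≤ (p i).2 + inner ℝ (g i) (x i) - ‖g i‖ ^ 2 := by
    have hcv : Convex ℝ {w : E × ℝ | w.2 + inner ℝ w.1 (x i) - inner ℝ (g i) w.1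
        ≤ (p i).2 + inner ℝ (g i) (x i) - ‖g i‖ ^ 2} := by
      refine convex_halfSpace_le (f := fun w : E × ℝ =>
        w.2 + inner ℝ w.1 (x i) - inner ℝ (g i) w.1) ⟨fun a b => ?_, fun c a => ?_⟩ _
      · simp only [Prod.fst_add, Prod.snd_add, inner_add_left, inner_add_right]; ring
      · simp only [Prod.smul_fst, Prod.smul_snd, real_inner_smul_left, real_inner_smul_right,
          smul_eq_mul]; ring
    refine fun w hw => convexHull_min ?_ hcv hw
    rintro _ ⟨j, rfl⟩
    have := h i j
    simp only [interpGap] at this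
    rw [norm_sub_sq_real, inner_sub_right] at this
    simp only [hp, Set.mem_ofPred_eq]
    linarith
  have h1 := hlin _ (hmK (x i))
  have h2 : A (x i) (p i) ≤ A (x i) (m (x i)) := hm (x i) (subset_convexHull ℝ _ ⟨i, rfl⟩)
  have h3 : ‖g i - (m (x i)).1‖ ^ 2 = _ := norm_sub_sq_real _ _
  simp only [hA] at h2
  have hp1 : (p i).1 = g i := rfl
  have hp2 : (p i).2 = f i - inner ℝ (g i) (x i) + 1 / 2 * ‖g i‖ ^ 2 := rfl
  rw [hp1] at h2
  -- Optimality of `p i` and maximality of `m (x i)` together force equal gradient components, by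
  -- strong concavity in that component.
  have h4 : ‖g i - (m (x i)).1‖ ^ 2 ≤ 0 := by linarith
  have h5 : g i = (m (x i)).1 := sub_eq_zero.1
    (norm_eq_zero.1 (pow_eq_zero_iff two_ne_zero |>.1 (le_antisymm h4 (sq_nonneg _))))
  rw [← h5, real_inner_self_eq_norm_sq] at h1
  rw [← h5] at h2
  refine ⟨?_, by rw [hF2]; exact h5.symm⟩
  simp only [hF, hA]
  rw [← h5]
  linarith

end Smooth


/-! ### The reference-free inequality for independent gradients -/

/-- First-order data of gradient descent with schedule `h` on a smooth convex function. -/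
structure IsGDData {n : ℕ} {V : Type*} [NormedAddCommGroup V] [InnerProductSpace ℝ V]
    (h : Fin n → ℝ) (x g : Fin (n + 1) → V) (f : Fin (n + 1) → ℝ) : Prop where
  step : ∀ i : Fin n, x i.succ = x i.castSucc - h i • g i.castSucc
  gap : ∀ i j, 0 ≤ interpGap x g f i j

theorem IsOneSmoothConvex.isGDData {E : Type*} [NormedAddCommGroup E] [InnerProductSpace ℝ E]
    [CompleteSpace E] {n : ℕ} {f : E → ℝ} (hf : IsOneSmoothConvex f) (h : Fin n → ℝ) (x₀ : E) :
    IsGDData h (gdIterates f h x₀) (fun i => gradient f (gdIterates f h x₀ i))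
      (fun i => f (gdIterates f h x₀ i)) where
  step i := gdIterates_succ f h x₀ i
  gap i j := hf.cocoercive (gdIterates f h x₀ j) (gdIterates f h x₀ i)

section Data

variable {n : ℕ} {h : Fin n → ℝ} {η : ℝ} {V : Type*} [NormedAddCommGroup V]
  [InnerProductSpace ℝ V]

theorem gdIterates_eq_of_step {E : Type*} [NormedAddCommGroup E] [InnerProductSpace ℝ E]
    [CompleteSpace E] {F : E → ℝ} {x g : Fin (n + 1) → E}
    (hstep : ∀ i : Fin n, x i.succ = x i.castSucc - h i • g i.castSucc)
    (hg : ∀ i, gradient F (x i) = g i) (i : Fin (n + 1)) : gdIterates F h (x 0) i = x i := by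
  induction i using Fin.induction with
  | zero => exact gdIterates_zero F h (x 0)
  | succ i ih => rw [gdIterates_succ, ih, hg, hstep]

/-- The pair (`xs`, `fs`) joins the data as `none`, with gradient 0; `hlow` and `hup` are its
interpolation inequalities with the iterates. An orthonormal basis carries everything to Euclidean
space, where the hypothesis applies to the interpolant. -/
theorem IsSComposable.bound_of_data [FiniteDimensional ℝ V] (hs : IsSComposable h η)
    {x g : Fin (n + 1) → V} {f : Fin (n + 1) → ℝ} (hd : IsGDData h x g f) (xs : V) (fs : ℝ)
    (hlow : ∀ i, 0 ≤ f i - fs - 1 / 2 * ‖g i‖ ^ 2)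
    (hup : ∀ j, 0 ≤ fs - f j - inner ℝ (g j) (xs - x j) - 1 / 2 * ‖g j‖ ^ 2) :
    (1 - η) / 2 * ‖g (Fin.last n)‖ ^ 2 + η ^ 2 / 2 * ‖x (Fin.last n) - xs‖ ^ 2
      + (η - η ^ 2) * (f (Fin.last n) - fs) ≤ η ^ 2 / 2 * ‖x 0 - xs‖ ^ 2 := by
  let L := (stdOrthonormalBasis ℝ V).repr
  obtain ⟨F, hF, hFi⟩ := exists_isOneSmoothConvex_interpolating
    (x := fun o : Option (Fin (n + 1)) => L (o.elim xs x))
    (g := fun o => L (o.elim 0 g)) (f := fun o => o.elim fs f) (by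
      rintro (_ | i) (_ | j) <;> simp only [interpGap, Option.elim, ← map_sub,
        LinearIsometryEquiv.inner_map_map, LinearIsometryEquiv.norm_map]
      · simp
      · simpa using hup j
      · simpa using hlow i
      · exact hd.gap i j)
  have hxs := hFi none
  have hx := fun i => hFi (some i)
  simp only [Option.elim, map_zero] at hxs hx
  have hmin : IsGlobalMinimizer F (L xs) := fun y => by
    have := hF.subgradient (L xs) y
    rw [hxs.2, inner_zero_left] at this
    linarith
  have hit := gdIterates_eq_of_step (h := h) (F := F) (x := fun i => L (x i))
    (g := fun i => L (g i)) (fun i => by rw [hd.step, map_sub, map_smul]) (fun i => (hx i).2)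
  have := hs.bound _ F hF _ hmin (L (x 0))
  rw [gdLast, hit, (hx _).1, (hx _).2, hxs.1, ← map_sub, ← map_sub] at this
  simpa only [LinearIsometryEquiv.norm_map] using this

theorem LinearIndependent.exists_inner_eq [FiniteDimensional ℝ V] {ι : Type*} {g : ι → V}
    (hg : LinearIndependent ℝ g) (c : ι → ℝ) : ∃ v : V, ∀ i, inner ℝ (g i) v = c i := by
  obtain ⟨φ, hφ⟩ := LinearMap.exists_extend
    ((Finsupp.linearCombination ℝ c).comp (hg.repr : _ →ₗ[ℝ] (ι →₀ ℝ)))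
  refine ⟨(InnerProductSpace.toDual ℝ V).symm φ.toContinuousLinearMap, fun i => ?_⟩
  rw [real_inner_comm, InnerProductSpace.toDual_symm_apply]
  have hi : g i ∈ Submodule.span ℝ (Set.range g) := Submodule.subset_span ⟨i, rfl⟩
  have := LinearMap.congr_fun hφ ⟨g i, hi⟩
  simp only [LinearMap.comp_apply, Submodule.subtype_apply] at this
  rw [LinearMap.coe_toContinuousLinearMap', this]
  simp [hg.repr_eq_single i ⟨g i, hi⟩ rfl]

theorem sum_castSucc_sub_succ (u : Fin (n + 1) → ℝ) :
    ∑ i : Fin n, (u i.castSucc - u i.succ) = u 0 - u (Fin.last n) := by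
  have h1 := Fin.sum_univ_succ u
  have h2 := Fin.sum_univ_castSucc u
  rw [Finset.sum_sub_distrib]
  linarith

theorem IsSComposable.rate_pos (hs : IsSComposable h η) : 0 < η := by
  have : 0 ≤ ∑ i, h i := Finset.sum_nonneg fun i _ => (hs.pos i).le
  rw [hs.rate_sum]; positivity

theorem IsSComposable.rate_mul (hs : IsSComposable h η) : η * (1 + ∑ i, h i) = 1 := by
  have : 0 ≤ ∑ i, h i := Finset.sum_nonneg fun i _ => (hs.pos i).le
  rw [hs.rate_sum]; field_simp

/-- The excess in the reference-free form of the s-composable inequality. -/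
noncomputable def sExcess {n : ℕ} {V : Type*} [NormedAddCommGroup V] (h : Fin n → ℝ)
    (g : Fin (n + 1) → V) (f : Fin (n + 1) → ℝ) : ℝ :=
  ∑ i, h i * (f i.castSucc - f (Fin.last n))
    - ∑ i, 1 / 2 * (h i * (h i - 1)) * ‖g i.castSucc‖ ^ 2
    - (∑ i, h i) * (1 + ∑ i, h i) / 2 * ‖g (Fin.last n)‖ ^ 2

theorem IsSComposable.sExcess_nonneg_of_linearIndependent [FiniteDimensional ℝ V]
    (hs : IsSComposable h η) {x g : Fin (n + 1) → V} {f : Fin (n + 1) → ℝ}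
    (hd : IsGDData h x g f) (hg : LinearIndependent ℝ g) : 0 ≤ sExcess h g f := by
  -- `c` plays the minimum value: low enough for `hlow`, while `xs` is chosen to make `hup` an
  -- equality for every j.
  obtain ⟨c, hc⟩ := (Set.finite_range fun i => f i - 1 / 2 * ‖g i‖ ^ 2).bddBelow
  obtain ⟨xs, hxs⟩ := hg.exists_inner_eq
    (fun i => c - f i + inner ℝ (g i) (x i) - 1 / 2 * ‖g i‖ ^ 2)
  have hb := hs.bound_of_data hd xs c
    (fun i => by have := hc ⟨i, rfl⟩; simp only at this; linarith)
    (fun j => by rw [inner_sub_right, hxs]; linarith)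
  have hη := hs.rate_pos
  set S := ∑ i, h i with hS
  have hηS : η * (1 + S) = 1 := hs.rate_mul
  have htel := sum_castSucc_sub_succ fun i => 1 / 2 * ‖x i - xs‖ ^ 2
  -- The equalities defining `xs` make each decrease of distance explicit in f_i and ‖g_i‖², so the
  -- sum is exact.
  have hterm : ∀ i : Fin n, 1 / 2 * ‖x i.castSucc - xs‖ ^ 2 - 1 / 2 * ‖x i.succ - xs‖ ^ 2
      = h i * (f i.castSucc - c) - 1 / 2 * (h i * (h i - 1)) * ‖g i.castSucc‖ ^ 2 := by
    intro i
    have h1 : x i.succ - xs = (x i.castSucc - xs) - h i • g i.castSucc := by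
      rw [hd.step]; abel
    rw [h1, norm_sub_sq_real (x i.castSucc - xs) (h i • _), real_inner_smul_right, real_inner_comm, inner_sub_right, hxs,
      norm_smul, mul_pow, Real.norm_eq_abs, sq_abs]
    ring
  simp only [hterm] at htel
  rw [Finset.sum_sub_distrib] at htel
  have hshift : ∑ i, h i * (f i.castSucc - c)
      = ∑ i, h i * (f i.castSucc - f (Fin.last n)) + S * (f (Fin.last n) - c) := by
    rw [hS, Finset.sum_mul, ← Finset.sum_add_distrib]
    exact Finset.sum_congr rfl fun i _ => by ring
  rw [hshift] at htel
  have h1 : 1 - η = η ^ 2 * (S * (1 + S)) := by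
    linear_combination (-1 - η * S) * hηS
  have h2 : η - η ^ 2 = η ^ 2 * S := by linear_combination -η * hηS
  rw [h1, h2] at hb
  refine nonneg_of_mul_nonneg_right (a := η ^ 2) ?_ (by positivity)
  rw [sExcess, ← hS]
  have := congrArg (η ^ 2 * ·) htel
  linarith

end Data


/-! ### Removing linear independence by perturbation, and the gradient inequality -/

section Lift

variable {n : ℕ} {h : Fin n → ℝ} {η : ℝ} {V W : Type*} [NormedAddCommGroup V]
  [InnerProductSpace ℝ V] [NormedAddCommGroup W] [InnerProductSpace ℝ W]

theorem interpGap_prod {ι : Type*} (x g : ι → V) (f : ι → ℝ) (y γ : ι → W) (ψ : ι → ℝ) (ε : ℝ)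
    (i j : ι) :
    interpGap (fun i => WithLp.toLp 2 (x i, ε • y i)) (fun i => WithLp.toLp 2 (g i, ε • γ i))
      (fun i => f i + ε ^ 2 * ψ i) i j = interpGap x g f i j + ε ^ 2 * interpGap y γ ψ i j := by
  simp only [interpGap, ← WithLp.toLp_sub, WithLp.prod_inner_apply, WithLp.toLp_fst,
    WithLp.toLp_snd,
    WithLp.prod_norm_sq_eq_of_L2, Prod.fst_sub, Prod.snd_sub, ← smul_sub, norm_smul,
    real_inner_smul_left, real_inner_smul_right, mul_pow, Real.norm_eq_abs, sq_abs]
  ring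

theorem IsGDData.prod {x g : Fin (n + 1) → V} {f : Fin (n + 1) → ℝ} (hd : IsGDData h x g f)
    {y γ : Fin (n + 1) → W} {ψ : Fin (n + 1) → ℝ} (hd' : IsGDData h y γ ψ) (ε : ℝ) :
    IsGDData h (fun i => WithLp.toLp 2 (x i, ε • y i)) (fun i => WithLp.toLp 2 (g i, ε • γ i))
      (fun i => f i + ε ^ 2 * ψ i) where
  step i := by
    rw [← WithLp.toLp_smul, ← WithLp.toLp_sub, hd.step, hd'.step, smul_sub, smul_comm ε]
    rfl
  gap i j := by
    rw [interpGap_prod]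
    have := hd.gap i j
    have := hd'.gap i j
    positivity

theorem sExcess_prod {n : ℕ} {V W : Type*} [NormedAddCommGroup V] [NormedAddCommGroup W]
    [NormedSpace ℝ W] (h : Fin n → ℝ) (g : Fin (n + 1) → V) (f : Fin (n + 1) → ℝ)
    (γ : Fin (n + 1) → W) (ψ : Fin (n + 1) → ℝ) (ε : ℝ) :
    sExcess h (fun i => WithLp.toLp 2 (g i, ε • γ i)) (fun i => f i + ε ^ 2 * ψ i)
      = sExcess h g f + ε ^ 2 * sExcess h γ ψ := by
  have h1 : ∀ i : Fin n, h i * (f i.castSucc + ε ^ 2 * ψ i.castSucc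
      - (f (Fin.last n) + ε ^ 2 * ψ (Fin.last n)))
      = h i * (f i.castSucc - f (Fin.last n))
        + ε ^ 2 * (h i * (ψ i.castSucc - ψ (Fin.last n))) := fun i => by ring
  have h2 : ∀ i : Fin n, 1 / 2 * (h i * (h i - 1)) * (‖g i.castSucc‖ ^ 2
      + ε ^ 2 * ‖γ i.castSucc‖ ^ 2) = 1 / 2 * (h i * (h i - 1)) * ‖g i.castSucc‖ ^ 2
      + ε ^ 2 * (1 / 2 * (h i * (h i - 1)) * ‖γ i.castSucc‖ ^ 2) := fun i => by ring
  simp only [sExcess, WithLp.prod_norm_sq_eq_of_L2, WithLp.toLp_fst, WithLp.toLp_snd, norm_smul, mul_pow, Real.norm_eq_abs, sq_abs,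
    h1, h2, Finset.sum_add_distrib, ← Finset.mul_sum]
  ring

open Polynomial in
/-- The residual polynomials of gradient descent with schedule `h` on quadratics, continued with
unit stepsizes. -/
noncomputable def residualPoly (h : Fin n → ℝ) : ℕ → ℝ[X]
  | 0 => 1
  | j + 1 => residualPoly h j * (1 - C (if hj : j < n then h ⟨j, hj⟩ else 1) * X)

open Polynomial in
theorem degree_residualPoly (hpos : ∀ i, 0 < h i) (j : ℕ) : (residualPoly h j).degree = j := by
  induction j with
  | zero => simp [residualPoly]
  | succ j ih =>
    have hc : -(if hj : j < n then h ⟨j, hj⟩ else 1) ≠ 0 := by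
      split_ifs with hj
      · exact neg_ne_zero.2 (hpos _).ne'
      · norm_num
    have : (1 - C (if hj : j < n then h ⟨j, hj⟩ else 1) * X : ℝ[X])
        = C (-(if hj : j < n then h ⟨j, hj⟩ else 1)) * X + C 1 := by
      rw [C_neg, C_1]; ring
    rw [residualPoly, degree_mul, ih, this, degree_linear hc]
    norm_cast

/-- Gradient descent data of a diagonal quadratic whose gradients are linearly independent. -/
theorem exists_isGDData_linearIndependent (hpos : ∀ i, 0 < h i) :
    ∃ (y γ : Fin (n + 1) → EuclideanSpace ℝ (Fin (n + 1))) (ψ : Fin (n + 1) → ℝ),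
      IsGDData h y γ ψ ∧ LinearIndependent ℝ γ := by
  -- The eigenvalues need only be distinct and in (0, 1]. A dependence among the gradients would
  -- give a polynomial of degree at most n vanishing at these n + 1 points.
  let a : Fin (n + 1) → ℝ := fun k => 1 / ((k : ℝ) + 1)
  have ha0 : ∀ k, 0 < a k := fun k => by positivity
  have ha1 : ∀ k, a k ≤ 1 := fun k => by
    simp only [a]; rw [div_le_one (by positivity)]; linarith [(k : ℕ).cast_nonneg (α := ℝ)]
  have hainj : Function.Injective a := fun k l hkl => by
    simp only [a, one_div, inv_inj, add_left_inj, Nat.cast_inj] at hkl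
    exact Fin.ext hkl
  let p : Fin (n + 1) → Fin (n + 1) → ℝ := fun j k => (residualPoly h j).eval (a k)
  refine ⟨fun j => WithLp.toLp 2 (p j), fun j => WithLp.toLp 2 fun k => a k * p j k,
    fun j => ∑ k, 1 / 2 * a k * p j k ^ 2, ⟨fun i => ?_, fun i j => ?_⟩, ?_⟩
  · ext k
    simp only [PiLp.sub_apply, PiLp.smul_apply, smul_eq_mul, p, Fin.val_succ, Fin.val_castSucc,
      residualPoly, Polynomial.eval_mul, Polynomial.eval_sub, Polynomial.eval_one,
      Polynomial.eval_C, Polynomial.eval_X, i.isLt, dite_true]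
    ring
  · have : interpGap (fun j => WithLp.toLp 2 (p j))
        (fun j => (WithLp.toLp 2 fun k => a k * p j k : EuclideanSpace ℝ (Fin (n + 1))))
        (fun j => ∑ k, 1 / 2 * a k * p j k ^ 2) i j
        = ∑ k, 1 / 2 * (a k * (1 - a k)) * (p i k - p j k) ^ 2 := by
      simp only [interpGap, EuclideanSpace.real_norm_sq_eq, PiLp.inner_apply, PiLp.sub_apply,
        RCLike.inner_apply, conj_trivial, Finset.mul_sum, ← Finset.sum_sub_distrib]
      exact Finset.sum_congr rfl fun k _ => by ring
    rw [this]
    refine Finset.sum_nonneg fun k _ => ?_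
    have := ha0 k
    have : 0 ≤ 1 - a k := sub_nonneg.2 (ha1 k)
    positivity
  · have hli : LinearIndependent ℝ (fun j : Fin (n + 1) => residualPoly h j) :=
      (Polynomial.Sequence.linearIndependent
        ⟨residualPoly h, degree_residualPoly hpos⟩).comp _ Fin.val_injective
    rw [Fintype.linearIndependent_iff] at hli ⊢
    intro c hc
    refine hli c (Polynomial.eq_zero_of_natDegree_lt_card_of_eval_eq_zero _ hainj
      (fun k => ?_) ?_)
    · have := congrArg (fun v : EuclideanSpace ℝ (Fin (n + 1)) => v k) hc
      simp only [WithLp.ofLp_sum, WithLp.ofLp_smul, Finset.sum_apply, Pi.smul_apply, smul_eq_mul,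
        PiLp.zero_apply] at this
      have h2 : ∑ j, c j * (a k * p j k) = a k * ∑ j, c j * p j k := by
        rw [Finset.mul_sum]; exact Finset.sum_congr rfl fun j _ => by ring
      rw [h2] at this
      simpa [Polynomial.eval_finsetSum] using (mul_eq_zero.1 this).resolve_left (ha0 k).ne'
    · rw [Fintype.card_fin]
      refine Nat.lt_succ_of_le (Polynomial.natDegree_sum_le_of_forall_le _ _ fun j _ => ?_)
      refine (Polynomial.natDegree_smul_le _ _).trans ?_
      rw [Polynomial.natDegree_eq_of_degree_eq_some (degree_residualPoly hpos j)]
      exact Nat.lt_succ_iff.1 j.isLt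

theorem IsSComposable.sExcess_nonneg [FiniteDimensional ℝ V] (hs : IsSComposable h η)
    {x g : Fin (n + 1) → V} {f : Fin (n + 1) → ℝ} (hd : IsGDData h x g f) :
    0 ≤ sExcess h g f := by
  obtain ⟨y, γ, ψ, hd', hli⟩ := exists_isGDData_linearIndependent hs.pos
  have key : ∀ ε : ℝ, 0 < ε → 0 ≤ sExcess h g f + ε ^ 2 * sExcess h γ ψ := by
    intro ε hε
    rw [← sExcess_prod]
    refine hs.sExcess_nonneg_of_linearIndependent (hd.prod hd' ε) ?_
    -- Independence in the second factor is enough, whatever the original gradients are.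
    refine LinearIndependent.of_comp (WithLp.sndₗ 2 ℝ V (EuclideanSpace ℝ (Fin (n + 1)))) ?_
    exact hli.units_smul fun _ => Units.mk0 ε hε.ne'
  have hcont : Continuous fun ε : ℝ => sExcess h g f + ε ^ 2 * sExcess h γ ψ := by fun_prop
  have hlim := (hcont.tendsto 0).mono_left (nhdsWithin_le_nhds (s := Set.Ioi 0))
  have := ge_of_tendsto hlim (eventually_mem_nhdsWithin.mono fun ε hε => key ε hε)
  simpa using this

theorem IsGDData.sum_smul {x g : Fin (n + 1) → V} {f : Fin (n + 1) → ℝ} (hd : IsGDData h x g f) :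
    ∑ i, h i • g i.castSucc = x 0 - x (Fin.last n) := by
  have h1 := Fin.sum_univ_succ x
  have h2 := Fin.sum_univ_castSucc x
  have h3 : ∀ i, h i • g i.castSucc = x i.castSucc - x i.succ := fun i => by
    rw [hd.step]; abel
  simp only [h3, Finset.sum_sub_distrib]
  rw [sub_eq_sub_iff_add_eq_add, ← h2, h1]

/-- In the sum of h_i times the gaps from k to i, the intermediate values and squared gradient norms
are exactly those of `sExcess` with opposite sign, and the distances to x_k telescope. -/
theorem IsSComposable.comparison [FiniteDimensional ℝ V] (hs : IsSComposable h η)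
    {x g : Fin (n + 1) → V} {f : Fin (n + 1) → ℝ} (hd : IsGDData h x g f) (k : Fin (n + 1)) :
    0 ≤ (∑ i, h i) * (f k - f (Fin.last n)) - 1 / 2 * ‖x k - x (Fin.last n)‖ ^ 2
      + 1 / 2 * ‖x k - x 0‖ ^ 2 - 1 / 2 * (∑ i, h i) * ‖g k‖ ^ 2
      + inner ℝ (g k) (x 0 - x (Fin.last n))
      - (∑ i, h i) * (1 + ∑ i, h i) / 2 * ‖g (Fin.last n)‖ ^ 2 := by
  have hkey := hs.sExcess_nonneg hd
  have htel := sum_castSucc_sub_succ fun i => 1 / 2 * ‖x k - x i‖ ^ 2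
  have hterm : ∀ i : Fin n, h i * interpGap x g f k i.castSucc
      = h i * (f k - f (Fin.last n)) - h i * (f i.castSucc - f (Fin.last n))
        + (1 / 2 * ‖x k - x i.castSucc‖ ^ 2 - 1 / 2 * ‖x k - x i.succ‖ ^ 2)
        + 1 / 2 * (h i * (h i - 1)) * ‖g i.castSucc‖ ^ 2
        - h i * (1 / 2 * ‖g k‖ ^ 2) + inner ℝ (g k) (h i • g i.castSucc) := by
    intro i
    have h1 : x k - x i.succ = (x k - x i.castSucc) + h i • g i.castSucc := by
      rw [hd.step]; abel
    rw [h1, interpGap, norm_sub_sq_real (g k), norm_add_sq_real, real_inner_smul_right,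
      real_inner_smul_right, norm_smul, mul_pow, Real.norm_eq_abs, sq_abs,
      real_inner_comm (g i.castSucc) (g k),
      real_inner_comm (g i.castSucc) (x k - x i.castSucc)]
    ring
  have hsum : 0 ≤ ∑ i : Fin n, h i * interpGap x g f k i.castSucc :=
    Finset.sum_nonneg fun i _ => mul_nonneg (hs.pos i).le (hd.gap _ _)
  simp only [hterm, Finset.sum_add_distrib, Finset.sum_sub_distrib, ← Finset.sum_mul,
    ← inner_sum, hd.sum_smul] at hsum
  rw [← Finset.sum_sub_distrib, htel] at hsum
  rw [sExcess] at hkey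
  linarith

theorem IsSComposable.gradient_bound_of_data [FiniteDimensional ℝ V] (hs : IsSComposable h η)
    {x g : Fin (n + 1) → V} {f : Fin (n + 1) → ℝ} (hd : IsGDData h x g f) :
    1 / 2 * ‖g 0 - η • (x 0 - x (Fin.last n)) - η • g (Fin.last n)‖ ^ 2
      + (∑ i, h i) * ‖g (Fin.last n)‖ ^ 2 ≤ f 0 - f (Fin.last n) := by
  have h0 := hs.comparison hd 0
  have hN := hs.comparison hd (Fin.last n)
  have hP := hd.gap 0 (Fin.last n)
  have hη := hs.rate_pos
  have hηS := hs.rate_mul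
  have hη1 : 0 ≤ 1 - η := by
    have := mul_nonneg hη.le (Finset.sum_nonneg fun i _ => (hs.pos i).le : 0 ≤ ∑ i, h i)
    linarith
  have hsplit : g 0 - η • (x 0 - x (Fin.last n)) - η • g (Fin.last n)
      = g 0 - η • ((x 0 - x (Fin.last n)) + g (Fin.last n)) := by rw [smul_add]; abel
  rw [hsplit, norm_sub_sq_real, norm_smul, mul_pow, Real.norm_eq_abs, sq_abs,
    real_inner_smul_right, inner_add_right, norm_add_sq_real,
    real_inner_comm (g (Fin.last n)) (x 0 - x (Fin.last n))]
  simp only [interpGap, sub_self, norm_zero, norm_sub_sq_real (g 0),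
    norm_sub_rev (x (Fin.last n)) (x 0)] at h0 hN hP
  set S := ∑ i, h i
  -- The weights are forced: f_0 - f_n gets η(S + 1) = 1, and ‖x_0 - x_n‖² gets -η/2 + η(1 - η)/2 =
  -- -η²/2, as in the expanded square. The last term only uses η(1 + S) = 1.
  linear_combination η * h0 + η * hP + η * (1 - η) * hN
    + (f 0 - f (Fin.last n) - 1 / 2 * ‖g 0‖ ^ 2
      + (1 / 2 - 1 / 2 * S - 1 / 2 * (1 - η) * (S + 1)) * ‖g (Fin.last n)‖ ^ 2) * hηS

end Lift


/-! ### The two bounds -/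

section Tight

variable {n : ℕ} {h : Fin n → ℝ} {η : ℝ}

theorem IsSComposable.sum_nonneg (hs : IsSComposable h η) : 0 ≤ ∑ i, h i :=
  Finset.sum_nonneg fun i _ => (hs.pos i).le

theorem IsSComposable.rate_le_one (hs : IsSComposable h η) : η ≤ 1 := by
  have := mul_nonneg hs.rate_pos.le hs.sum_nonneg
  linarith [hs.rate_mul]

theorem IsSComposable.one_div_one_add_two_mul_sum (hs : IsSComposable h η) :
    1 / (1 + 2 * ∑ i, h i) = η / (2 - η) := by
  have := hs.sum_nonneg
  have := hs.rate_le_one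
  rw [div_eq_div_iff (by positivity) (by linarith)]
  linear_combination (-2) * hs.rate_mul

theorem IsSComposable.objective_bound (hs : IsSComposable h η) {d : ℕ}
    {f : EuclideanSpace ℝ (Fin d) → ℝ} (hf : IsOneSmoothConvex f) {xs : EuclideanSpace ℝ (Fin d)}
    (hxs : IsGlobalMinimizer f xs) (x₀ : EuclideanSpace ℝ (Fin d)) :
    f (gdLast f h x₀) - f xs ≤ 1 / (1 + 2 * ∑ i, h i) * objBracket f h η x₀ xs := by
  have hb := hs.bound d f hf xs hxs x₀
  have hη := hs.rate_pos
  have hη1 := hs.rate_le_one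
  rw [hs.one_div_one_add_two_mul_sum, objBracket]
  set y := gdLast f h x₀
  have hc := hf.cocoercive y xs
  simp only [interpGap, id, hf.gradient_eq_zero hxs, zero_sub, norm_neg] at hc
  rw [← neg_sub y xs, inner_neg_right, real_inner_comm] at hc
  rw [norm_sub_sq_real (y - xs), norm_smul, mul_pow, real_inner_smul_right, Real.norm_eq_abs,
    sq_abs, div_mul_eq_mul_div, le_div_iff₀ (by linarith)]
  refine le_of_mul_le_mul_left ?_ hη
  have e : η * (η * (1 / 2 * ‖x₀ - xs‖ ^ 2 - 1 / 2 * (‖y - xs‖ ^ 2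
      - 2 * (1 / η * inner ℝ (y - xs) (gradient f y)) + (1 / η) ^ 2 * ‖gradient f y‖ ^ 2)))
      = η ^ 2 / 2 * ‖x₀ - xs‖ ^ 2 - η ^ 2 / 2 * ‖y - xs‖ ^ 2
        + η * inner ℝ (y - xs) (gradient f y) - 1 / 2 * ‖gradient f y‖ ^ 2 := by
    field_simp
    ring
  rw [e]
  have := mul_nonneg hη.le hc
  linarith

theorem IsSComposable.gradient_bound (hs : IsSComposable h η) {d : ℕ}
    {f : EuclideanSpace ℝ (Fin d) → ℝ} (hf : IsOneSmoothConvex f) {xs : EuclideanSpace ℝ (Fin d)}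
    (hxs : IsGlobalMinimizer f xs) (x₀ : EuclideanSpace ℝ (Fin d)) :
    1 / 2 * ‖gradient f (gdLast f h x₀)‖ ^ 2
      ≤ 1 / (1 + 2 * ∑ i, h i) * gradBracket f h η x₀ xs := by
  have hd := hf.isGDData h x₀
  have hb := hs.gradient_bound_of_data hd
  have hS := hs.sum_nonneg
  have hc := hf.cocoercive xs (gdLast f h x₀)
  simp only [interpGap, id, hf.gradient_eq_zero hxs, inner_zero_left, sub_zero] at hc
  rw [one_div_mul_eq_div (1 + 2 * ∑ i, h i), le_div_iff₀ (by positivity), gradBracket, hd.sum_smul]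
  rw [gdIterates_zero] at hb ⊢
  simp only [gdLast] at hc hb ⊢
  linarith

/-! ### Tightness on the quadratic and the Huber functions -/

theorem isOneSmoothConvex_quadFun : IsOneSmoothConvex quadFun ∧ gradient quadFun = id := by
  refine isOneSmoothConvex_of_cocoercive fun x y => le_of_eq ?_
  simp only [interpGap, id, quadFun, RCLike.inner_apply, conj_trivial, Real.norm_eq_abs, sq_abs]
  ring

theorem gdIterates_quadFun (h : Fin n → ℝ) (i : Fin (n + 1)) :
    gdIterates quadFun h 1 i = ∏ j : Fin i, (1 - h (j.castLE (Nat.lt_succ_iff.1 i.isLt))) := by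
  induction i using Fin.induction with
  | zero => exact (Fin.prod_univ_zero _).symm
  | succ i ih =>
    rw [gdIterates_succ, ih, isOneSmoothConvex_quadFun.2]
    simp only [Fin.val_succ, Fin.prod_univ_castSucc, Fin.val_castSucc, id, smul_eq_mul]
    have : ((Fin.last (i : ℕ)).castLE (Nat.lt_succ_iff.1 i.succ.isLt) : Fin n) = i := rfl
    rw [this]
    simp only [Fin.castLE_castSucc]
    ring

/-- The last iterate is ∏(1 - h_i), which is η up to a sign depending on the parity of n; this is
where the product formula for η enters. -/
theorem IsSComposable.gdLast_quadFun_sq (hs : IsSComposable h η) :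
    gdLast quadFun h 1 ^ 2 = η ^ 2 := by
  rw [gdLast, gdIterates_quadFun, hs.rate_prod, ← Finset.prod_pow, ← Finset.prod_pow]
  exact Finset.prod_congr rfl fun i _ => by simp only [Fin.castLE_rfl, id]; ring

theorem isGlobalMinimizer_quadFun : IsGlobalMinimizer quadFun 0 := fun y => by
  simp only [quadFun]; nlinarith [sq_nonneg y]

theorem IsSComposable.objective_bound_quadFun (hs : IsSComposable h η) :
    quadFun (gdLast quadFun h 1) - quadFun 0
      = 1 / (1 + 2 * ∑ i, h i) * objBracket quadFun h η 1 0 := by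
  have hη := hs.rate_pos
  have h2 : 2 - η ≠ 0 := by linarith [hs.rate_le_one]
  have hy := hs.gdLast_quadFun_sq
  rw [hs.one_div_one_add_two_mul_sum, objBracket, isOneSmoothConvex_quadFun.2]
  set y := gdLast quadFun h 1
  simp only [quadFun, id, smul_eq_mul, Real.norm_eq_abs, sq_abs, sub_zero]
  have e : (y - 1 / η * y) ^ 2 = (1 - 1 / η) ^ 2 * y ^ 2 := by ring
  rw [e, hy]
  field_simp
  ring

theorem IsSComposable.gradient_bound_quadFun (hs : IsSComposable h η) :
    1 / 2 * ‖gradient quadFun (gdLast quadFun h 1)‖ ^ 2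
      = 1 / (1 + 2 * ∑ i, h i) * gradBracket quadFun h η 1 0 := by
  have hη := hs.rate_pos
  have h2 : 2 - η ≠ 0 := by linarith [hs.rate_le_one]
  have hy := hs.gdLast_quadFun_sq
  rw [hs.one_div_one_add_two_mul_sum, gradBracket,
    (isOneSmoothConvex_quadFun.1.isGDData h 1).sum_smul, isOneSmoothConvex_quadFun.2,
    gdIterates_zero, ← gdLast]
  set y := gdLast quadFun h 1
  simp only [quadFun, id, smul_eq_mul, Real.norm_eq_abs, sq_abs, hy]
  field_simp
  ring

theorem isOneSmoothConvex_huberFun {δ : ℝ} (hδ : 0 ≤ δ) :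
    IsOneSmoothConvex (huberFun δ) ∧
      gradient (huberFun δ) = fun x => max (-δ) (min δ x) := by
  refine isOneSmoothConvex_of_cocoercive fun x y => ?_
  have hcases : ∀ z : ℝ,
      (-δ ≤ z ∧ z ≤ δ ∧ huberFun δ z = 1 / 2 * z ^ 2 ∧ max (-δ) (min δ z) = z) ∨
      (δ < z ∧ δ < z ∧ huberFun δ z = δ * z - δ ^ 2 / 2 ∧ max (-δ) (min δ z) = δ) ∨
      (z < -δ ∧ z < -δ ∧ huberFun δ z = δ * -z - δ ^ 2 / 2 ∧ max (-δ) (min δ z) = -δ) := by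
    intro z
    by_cases hz : |z| ≤ δ
    · have := abs_le.1 hz
      exact Or.inl ⟨this.1, this.2, if_pos hz, by rw [min_eq_right this.2, max_eq_right this.1]⟩
    · rcases lt_abs.1 (not_le.1 hz) with h | h
      · exact Or.inr (Or.inl ⟨h, h, by rw [huberFun, if_neg hz, abs_of_pos (by linarith)],
          by rw [min_eq_left h.le, max_eq_right (by linarith)]⟩)
      · exact Or.inr (Or.inr ⟨by linarith, by linarith,
          by rw [huberFun, if_neg hz, abs_of_neg (by linarith)],
          by rw [min_eq_right (by linarith), max_eq_left (by linarith)]⟩)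
  simp only [interpGap, id, RCLike.inner_apply, conj_trivial, Real.norm_eq_abs, sq_abs]
  rcases hcases x with ⟨a1, a2, a3, a4⟩ | ⟨a1, a2, a3, a4⟩ | ⟨a1, a2, a3, a4⟩ <;>
    rcases hcases y with ⟨b1, b2, b3, b4⟩ | ⟨b1, b2, b3, b4⟩ | ⟨b1, b2, b3, b4⟩ <;>
    rw [a3, a4, b3, b4] <;> nlinarith

theorem huberFun_of_ge {δ x : ℝ} (hδ : 0 ≤ δ) (hx : δ ≤ x) :
    huberFun δ x = δ * x - δ ^ 2 / 2 := by
  rw [huberFun, abs_of_nonneg (hδ.trans hx)]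
  split_ifs with h
  · rw [le_antisymm h hx]; ring
  · rfl

theorem huberFun_zero {δ : ℝ} (hδ : 0 ≤ δ) : huberFun δ 0 = 0 := by simp [huberFun, hδ]

theorem isGlobalMinimizer_huberFun {δ : ℝ} (hδ : 0 ≤ δ) : IsGlobalMinimizer (huberFun δ) 0 := by
  intro y
  rw [huberFun_zero hδ, huberFun]
  split_ifs with h
  · positivity
  · nlinarith

theorem gradient_huberFun_of_ge {δ x : ℝ} (hδ : 0 ≤ δ) (hx : δ ≤ x) :
    gradient (huberFun δ) x = δ := by
  rw [(isOneSmoothConvex_huberFun hδ).2]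
  beta_reduce
  rw [min_eq_left hx, max_eq_right (by linarith)]

/-- If the total displacement is small enough, gradient descent on the Huber function stays in the
linear region. -/
theorem gdIterates_huberFun {δ : ℝ} (hδ : 0 ≤ δ) (hpos : ∀ i, 0 < h i)
    (hS : δ ≤ 1 - δ * ∑ i, h i) (i : Fin (n + 1)) :
    gdIterates (huberFun δ) h 1 i
        = 1 - δ * ∑ j : Fin i, h (j.castLE (Nat.lt_succ_iff.1 i.isLt)) ∧
      δ ≤ gdIterates (huberFun δ) h 1 i := by
  have hle : ∀ i : Fin (n + 1),
      δ ≤ 1 - δ * ∑ j : Fin i, h (j.castLE (Nat.lt_succ_iff.1 i.isLt)) := by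
    intro i
    refine hS.trans (sub_le_sub_left (mul_le_mul_of_nonneg_left ?_ hδ) _)
    rw [← Finset.sum_image (f := h) (s := Finset.univ)
      (g := fun j : Fin i => j.castLE (Nat.lt_succ_iff.1 i.isLt))
      (fun a _ b _ hab => Fin.castLE_injective _ hab)]
    exact Finset.sum_le_univ_sum_of_nonneg fun j => (hpos j).le
  suffices he : gdIterates (huberFun δ) h 1 i
      = 1 - δ * ∑ j : Fin i, h (j.castLE (Nat.lt_succ_iff.1 i.isLt)) from ⟨he, he ▸ hle i⟩
  induction i using Fin.induction with
  | zero =>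
    rw [gdIterates_zero]
    exact (by rw [Fin.sum_univ_zero, mul_zero, sub_zero] :
      (1 : ℝ) = 1 - δ * ∑ j : Fin 0, h (j.castLE n.zero_le))
  | succ i ih =>
    rw [gdIterates_succ, gradient_huberFun_of_ge hδ (ih ▸ hle i.castSucc), ih]
    simp only [Fin.val_succ, Fin.sum_univ_castSucc, Fin.val_castSucc, smul_eq_mul]
    have : ((Fin.last (i : ℕ)).castLE (Nat.lt_succ_iff.1 i.succ.isLt) : Fin n) = i := rfl
    rw [this]
    simp only [Fin.castLE_castSucc]
    ring

theorem gdLast_huberFun {δ : ℝ} (hδ : 0 ≤ δ) (hpos : ∀ i, 0 < h i)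
    (hS : δ ≤ 1 - δ * ∑ i, h i) : gdLast (huberFun δ) h 1 = 1 - δ * ∑ i, h i :=
  (gdIterates_huberFun hδ hpos hS (Fin.last n)).1

/-- With δ = η/(2 - η) = 1/(1 + 2S), the last iterate is 1 - δS = 1/(2 - η) = δ/η, still on the
linear piece, so the residual x_n - g_n/η vanishes. -/
theorem IsSComposable.objective_bound_huberFun (hs : IsSComposable h η) :
    huberFun (η / (2 - η)) (gdLast (huberFun (η / (2 - η))) h 1) - huberFun (η / (2 - η)) 0
        = 1 / (1 + 2 * ∑ i, h i) * objBracket (huberFun (η / (2 - η))) h η 1 0 ∧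
      objBracket (huberFun (η / (2 - η))) h η 1 0 = 1 / 2 * ‖(1 : ℝ) - 0‖ ^ 2 := by
  have hη := hs.rate_pos
  have hη1 := hs.rate_le_one
  have h2 : 0 < 2 - η := by linarith
  have hδ : 0 ≤ η / (2 - η) := by positivity
  have hlast : 1 - η / (2 - η) * ∑ i, h i = 1 / (2 - η) := by
    field_simp
    linear_combination -hs.rate_mul
  have hle : η / (2 - η) ≤ 1 / (2 - η) := by gcongr
  have hy := gdLast_huberFun hδ hs.pos (hlast ▸ hle)
  rw [hlast] at hy
  have hbr : objBracket (huberFun (η / (2 - η))) h η 1 0 = 1 / 2 * ‖(1 : ℝ) - 0‖ ^ 2 := by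
    rw [objBracket, hy, gradient_huberFun_of_ge hδ hle, smul_eq_mul]
    have : 1 / (2 - η) - 0 - 1 / η * (η / (2 - η)) = 0 := by field_simp; ring
    rw [this]
    simp
  refine ⟨?_, hbr⟩
  rw [hbr, hy, huberFun_of_ge hδ hle, huberFun_zero hδ, hs.one_div_one_add_two_mul_sum]
  simp only [sub_zero, norm_one]
  field_simp

/-- With δ = η the last iterate is 1 - ηS = η, exactly at the kink. All gradients equal η, and the
residual η - η²(S + 1) vanishes. -/
theorem IsSComposable.gradient_bound_huberFun (hs : IsSComposable h η) :
    1 / 2 * ‖gradient (huberFun η) (gdLast (huberFun η) h 1)‖ ^ 2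
        = 1 / (1 + 2 * ∑ i, h i) * gradBracket (huberFun η) h η 1 0 ∧
      gradBracket (huberFun η) h η 1 0 = huberFun η 1 - huberFun η 0 := by
  have hη := hs.rate_pos
  have hη1 := hs.rate_le_one
  have h2 : 0 < 2 - η := by linarith
  have hlast : 1 - η * ∑ i, h i = η := by linear_combination -hs.rate_mul
  have hy := gdLast_huberFun hη.le hs.pos hlast.ge
  rw [hlast] at hy
  have hbr : gradBracket (huberFun η) h η 1 0 = huberFun η 1 - huberFun η 0 := by
    rw [gradBracket, ((isOneSmoothConvex_huberFun hη.le).1.isGDData h 1).sum_smul,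
      gdIterates_zero, ← gdLast, hy, gradient_huberFun_of_ge hη.le le_rfl,
      gradient_huberFun_of_ge hη.le hη1]
    have : η - η • (1 - η) - η • η = 0 := by simp only [smul_eq_mul]; ring
    rw [this]
    simp
  refine ⟨?_, hbr⟩
  rw [hbr, hy, gradient_huberFun_of_ge hη.le le_rfl, huberFun_of_ge hη.le hη1,
    huberFun_zero hη.le, hs.one_div_one_add_two_mul_sum, Real.norm_eq_abs, sq_abs]
  field_simp
  ring

end Tight

theorem mainTheorem5 {n : ℕ} (h : Fin n → ℝ) (η : ℝ) (hs : IsSComposable h η) :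
    -- the two bounds, in every dimension
    (∀ (d : ℕ) (f : EuclideanSpace ℝ (Fin d) → ℝ), IsOneSmoothConvex f →
      ∀ xs, IsGlobalMinimizer f xs → ∀ x₀,
        f (gdLast f h x₀) - f xs ≤ 1 / (1 + 2 * ∑ i, h i) * objBracket f h η x₀ xs ∧
        1 / 2 * ‖gradient f (gdLast f h x₀)‖ ^ 2
          ≤ 1 / (1 + 2 * ∑ i, h i) * gradBracket f h η x₀ xs) ∧
    -- both bounds are attained by `q`, from `x₀ = 1`
    (IsOneSmoothConvex quadFun ∧ IsGlobalMinimizer quadFun 0 ∧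
      quadFun (gdLast quadFun h 1) - quadFun 0
        = 1 / (1 + 2 * ∑ i, h i) * objBracket quadFun h η 1 0 ∧
      1 / 2 * ‖gradient quadFun (gdLast quadFun h 1)‖ ^ 2
        = 1 / (1 + 2 * ∑ i, h i) * gradBracket quadFun h η 1 0) ∧
    -- the first bound is attained by `H_{η/(2-η)}`, from `x₀ = 1`
    (IsOneSmoothConvex (huberFun (η / (2 - η))) ∧
      IsGlobalMinimizer (huberFun (η / (2 - η))) 0 ∧
      huberFun (η / (2 - η)) (gdLast (huberFun (η / (2 - η))) h 1) - huberFun (η / (2 - η)) 0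
        = 1 / (1 + 2 * ∑ i, h i) * objBracket (huberFun (η / (2 - η))) h η 1 0 ∧
      objBracket (huberFun (η / (2 - η))) h η 1 0 = 1 / 2 * ‖(1 : ℝ) - 0‖ ^ 2) ∧
    -- the second bound is attained by `H_η`, from `x₀ = 1`
    (IsOneSmoothConvex (huberFun η) ∧ IsGlobalMinimizer (huberFun η) 0 ∧
      1 / 2 * ‖gradient (huberFun η) (gdLast (huberFun η) h 1)‖ ^ 2
        = 1 / (1 + 2 * ∑ i, h i) * gradBracket (huberFun η) h η 1 0 ∧
      gradBracket (huberFun η) h η 1 0 = huberFun η 1 - huberFun η 0) := by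
  have hη := hs.rate_pos
  have h2 : 0 < 2 - η := by linarith [hs.rate_le_one]
  have hδ : 0 ≤ η / (2 - η) := by positivity
  exact ⟨fun d f hf xs hxs x₀ => ⟨hs.objective_bound hf hxs x₀, hs.gradient_bound hf hxs x₀⟩,
    ⟨isOneSmoothConvex_quadFun.1, isGlobalMinimizer_quadFun, hs.objective_bound_quadFun,
      hs.gradient_bound_quadFun⟩,
    ⟨(isOneSmoothConvex_huberFun hδ).1, isGlobalMinimizer_huberFun hδ,
      hs.objective_bound_huberFun⟩,
    ⟨(isOneSmoothConvex_huberFun hη.le).1, isGlobalMinimizer_huberFun hη.le,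
      hs.gradient_bound_huberFun⟩⟩
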